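/- Let $\Omega$ be a compact metric space and let $\mathcal M(\Omega)$ be the space of finite signed Radon (equivalently, Borel) measures on $\Omega$. Let $c:\mathbb R\times\mathbb R\times\Omega\to[0,\infty]$ be a spatially varying local discrepancy integrand, that is: (a) $c$ is lower semicontinuous jointly in $(m_0,m_1,x)$, and for every $x\in\Omega$ the function $(m_0,m_1)\mapsto c(m_0,m_1,x)$ is convex and positively $1$-homogeneous; (b) for every $x\in\Omega$, $c(m,m,x)=0$ for all $m\ge 0$, and $c(m_0,m_1,x)>0$ whenever $m_0\ne m_1$; (c) for every $x\in\Omega$, $c(m_0,m_1,x)=\infty$ whenever $m_0<0$ or $m_1<0$. For $\rho_0,\rho_1\in\mathcal M(\Omega)$ define the local discrepancy $$D(\rho_0,\rho_1)=\int_\Omega c\Big(\frac{\mathrm d\rho_0}{\mathrm d\rho}(x),\frac{\mathrm d\rho_1}{\mathrm d\rho}(x),x\Big)\,\mathrm d\rho(x)\in[0,\infty],$$ where $\rho$ is any finite nonnegative Borel measure on $\Omega$ with $\rho_0,\rho_1\ll\rho$, for instance $\rho=|\rho_0|+|\rho_1|$ (by homogeneity the value does not depend on the choice of $\rho$). Then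 $D:\mathcal M(\Omega)^2\to[0,\infty]$ is lower semicontinuous with respect to the weak-* topology on $\mathcal M(\Omega)^2$, regarded as the topological dual of $C(\Omega)^2$ via the pairing $\langle (u_0,u_1),(\rho_0,\rho_1)\rangle=\int_\Omega u_0\,\mathrm d\rho_0+\int_\Omega u_1\,\mathrm d\rho_1$. -/

import Mathlib

open MeasureTheory MeasureTheory.VectorMeasure
open scoped ENNReal NNReal

/-- A spatially varying integrand `c : ℝ × ℝ × Ω → [0,∞]` of a local discrepancy.
Since `c` is lower semicontinuous in all its arguments, it is in particular Borel measurable. -/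
structure IsLocalDiscrepancyIntegrand {Ω : Type*} [TopologicalSpace Ω]
    (c : ℝ → ℝ → Ω → ℝ≥0∞) : Prop where
  /-- `c` is lower semicontinuous jointly in all three arguments. -/
  lowerSemicontinuous : LowerSemicontinuous (fun p : ℝ × ℝ × Ω => c p.1 p.2.1 p.2.2)
  /-- `c (·, ·, x)` is convex (the weights of convex combinations are taken in `ℝ≥0`, over which
  `[0,∞]` is a module). -/
  convex : ∀ x, ConvexOn ℝ≥0 Set.univ (fun m : ℝ × ℝ => c m.1 m.2 x)
  /-- `c (·, ·, x)` is positively 1-homogeneous. -/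
  homogeneous : ∀ (x : Ω) (t m₀ m₁ : ℝ), 0 < t →
    c (t * m₀) (t * m₁) x = ENNReal.ofReal t * c m₀ m₁ x
  diag : ∀ (x : Ω) (m : ℝ), 0 ≤ m → c m m x = 0
  pos : ∀ (x : Ω) (m₀ m₁ : ℝ), m₀ ≠ m₁ → 0 < c m₀ m₁ x
  eq_top : ∀ (x : Ω) (m₀ m₁ : ℝ), m₀ < 0 ∨ m₁ < 0 → c m₀ m₁ x = ∞

/-- `∫ c(dρ₀/dρ (x), dρ₁/dρ (x), x) dρ(x)` for a given reference measure `ρ`. -/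
noncomputable def discrepancyIntegral {Ω : Type*} [MeasurableSpace Ω]
    (c : ℝ → ℝ → Ω → ℝ≥0∞) (ρ : Measure Ω) (ρ₀ ρ₁ : SignedMeasure Ω) : ℝ≥0∞ :=
  ∫⁻ x, c (ρ₀.rnDeriv ρ x) (ρ₁.rnDeriv ρ x) x ∂ρ

/-- The local discrepancy `D(ρ₀, ρ₁)` induced by `c`, with the reference measure `|ρ₀| + |ρ₁|`.
By `localDiscrepancy_eq_discrepancyIntegral` below, any other finite reference measure `ρ` with
`ρ₀, ρ₁ ≪ ρ` gives the same value. -/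
noncomputable def localDiscrepancy {Ω : Type*} [MeasurableSpace Ω]
    (c : ℝ → ℝ → Ω → ℝ≥0∞) (ρ₀ ρ₁ : SignedMeasure Ω) : ℝ≥0∞ :=
  discrepancyIntegral c (ρ₀.totalVariation + ρ₁.totalVariation) ρ₀ ρ₁

/-- The dual pairing of `(u₀, u₁) ∈ C(Ω)²` with a pair `(ρ₀, ρ₁)` of signed measures. -/
noncomputable def dualPairing {Ω : Type*} [TopologicalSpace Ω] [MeasurableSpace Ω]
    (u : C(Ω, ℝ) × C(Ω, ℝ)) (ρ : SignedMeasure Ω × SignedMeasure Ω) : ℝ :=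
  (∫ᵛ x, u.1 x ∂<•ρ.1) + ∫ᵛ x, u.2 x ∂<•ρ.2

/-- The weak-* topology on `M(Ω)²`, the dual space of `C(Ω)²`: the coarsest topology that makes
the pairing with every `u ∈ C(Ω)²` continuous. (On a compact metric space every finite signed
Borel measure is Radon.) -/
@[reducible] noncomputable def weakStarTopology (Ω : Type*) [TopologicalSpace Ω] [MeasurableSpace Ω] :
    TopologicalSpace (SignedMeasure Ω × SignedMeasure Ω) :=
  ⨅ u : C(Ω, ℝ) × C(Ω, ℝ), TopologicalSpace.induced (dualPairing u) inferInstance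

theorem signedMeasure_rnDeriv_chain {Ω : Type*} [MeasurableSpace Ω] (s : SignedMeasure Ω)
    (μ ρ : Measure Ω) [IsFiniteMeasure μ] [IsFiniteMeasure ρ]
    (hs : s.totalVariation ≪ μ) (hμ : μ ≪ ρ) :
    (fun x => (μ.rnDeriv ρ x).toReal * s.rnDeriv μ x) =ᵐ[ρ] s.rnDeriv ρ := by
  have hs' : s ≪ᵥ μ.toENNRealVectorMeasure := by
    rw [SignedMeasure.absolutelyContinuous_ennreal_iff]
    exact hs.trans (le_of_eq (VectorMeasure.equivMeasure.right_inv μ).symm).absolutelyContinuous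
  have h1 : μ.withDensityᵥ (s.rnDeriv μ) = s := SignedMeasure.withDensityᵥ_rnDeriv_eq s μ hs'
  have hint : Integrable (s.rnDeriv μ) μ := SignedMeasure.integrable_rnDeriv s μ
  refine SignedMeasure.eq_rnDeriv 0 _ ((integrable_rnDeriv_smul_iff hμ).mpr hint)
    (VectorMeasure.MutuallySingular.zero_left) ?_
  rw [zero_add]
  exact (h1.symm.trans (withDensityᵥ_rnDeriv_smul hμ hint).symm)

/-- The local discrepancy does not depend on the choice of the reference measure. -/
theorem localDiscrepancy_eq_discrepancyIntegral {Ω : Type*} [MetricSpace Ω] [CompactSpace Ω]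
    [MeasurableSpace Ω] [BorelSpace Ω] {c : ℝ → ℝ → Ω → ℝ≥0∞}
    (hc : IsLocalDiscrepancyIntegrand c) (ρ₀ ρ₁ : SignedMeasure Ω) (ρ : Measure Ω)
    [IsFiniteMeasure ρ] (h₀ : ρ₀.totalVariation ≪ ρ) (h₁ : ρ₁.totalVariation ≪ ρ) :
    localDiscrepancy c ρ₀ ρ₁ = discrepancyIntegral c ρ ρ₀ ρ₁ := by
  set μ := ρ₀.totalVariation + ρ₁.totalVariation with hμdef
  have hμ : μ ≪ ρ := by
    intro s hs
    simp [hμdef, h₀ hs, h₁ hs]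
  have e₀ := signedMeasure_rnDeriv_chain ρ₀ μ ρ
    (Measure.le_add_right le_rfl).absolutelyContinuous hμ
  have e₁ := signedMeasure_rnDeriv_chain ρ₁ μ ρ
    (Measure.le_add_left le_rfl).absolutelyContinuous hμ
  have hmeas : Measurable (fun x => c (ρ₀.rnDeriv μ x) (ρ₁.rnDeriv μ x) x) :=
    hc.lowerSemicontinuous.measurable.comp ((SignedMeasure.measurable_rnDeriv ρ₀ μ).prodMk
      ((SignedMeasure.measurable_rnDeriv ρ₁ μ).prodMk measurable_id))
  unfold localDiscrepancy discrepancyIntegral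
  rw [← hμdef, ← lintegral_rnDeriv_mul hμ hmeas.aemeasurable]
  refine lintegral_congr_ae ?_
  filter_upwards [e₀, e₁, μ.rnDeriv_lt_top ρ] with x hx₀ hx₁ hx
  rw [← hx₀, ← hx₁]
  rcases (ENNReal.toReal_nonneg (a := μ.rnDeriv ρ x)).eq_or_lt with h | h
  · have h0 : μ.rnDeriv ρ x = 0 := by
      rcases (ENNReal.toReal_eq_zero_iff _).mp h.symm with h | h
      · exact h
      · exact absurd h hx.ne
    simp [h0, hc.diag x 0 le_rfl]
  · rw [hc.homogeneous x _ _ _ h, ENNReal.ofReal_toReal hx.ne]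

/-!
The local discrepancy is a supremum of weak-* continuous functions, by the dual formula
`localDiscrepancy_eq_iSup_dualPairing`: `D(ρ)` is the supremum of the pairings `⟨u, ρ⟩` over the
admissible `u ∈ C(Ω)²`, those with `u(x) · m ≤ c(m, x)` for all `m` and `x`. The inequality
`⟨u, ρ⟩ ≤ D(ρ)` is immediate; the converse rests on two facts.

* Pointwise, `c(m, x)` is the supremum of `u(x) · m` over admissible `u`
  (`IsLocalDiscrepancyIntegrand.exists_isAdmissible`). Separating a point from the epigraph of
  `c (·, ·, x)`, a closed convex cone, gives a linear minorant `b`. Since `c` is infinite outside the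
  positive quadrant, a small decrease of `b` makes the inequality strict away from the origin; by
  joint lower semicontinuity and compactness of the unit sphere, the constant `b` then remains a
  minorant at all points near `x`. As `c ≥ 0`, multiplying `b` by a cutoff function makes it
  admissible, so no continuous selection theorem is needed.

* Let `r` be the pair of densities of `ρ` with respect to `μ = |ρ₀| + |ρ₁|`. The closure in `L¹(μ)`
  of the functions `u · r` with `u` admissible is stable under maxima (`IsAdmissibleLimit.max`),
  because admissible pairs are stable under convex combinations with continuous weights
  (`IsAdmissible.blend`), and such weights approximate the indicator of the set where one function
  exceeds the other (`exists_continuous_blend_lintegral_le`).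

As `C(Ω)` is separable, countably many admissible `u` recover `c` everywhere, so that `c(r(x), x)` is
an increasing limit of finite maxima of functions `u · r`, and monotone convergence concludes.
-/

/-! ### Linear minorants of the integrand -/

namespace IsLocalDiscrepancyIntegrand

variable {Ω : Type*} [TopologicalSpace Ω] {c : ℝ → ℝ → Ω → ℝ≥0∞}

theorem add_le (hc : IsLocalDiscrepancyIntegrand c) (x : Ω) (a₀ a₁ b₀ b₁ : ℝ) :
    c (a₀ + b₀) (a₁ + b₁) x ≤ c a₀ a₁ x + c b₀ b₁ x := by
  have h := (hc.convex x).2 (Set.mem_univ (2 * a₀, 2 * a₁)) (Set.mem_univ (2 * b₀, 2 * b₁))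
    (zero_le (a := (1 / 2 : ℝ≥0))) (zero_le (a := (1 / 2 : ℝ≥0))) (add_halves 1)
  simp only [Prod.smul_mk, Prod.mk_add_mk, NNReal.smul_def, smul_eq_mul, ENNReal.smul_def,
    hc.homogeneous x 2 _ _ two_pos, ← mul_assoc] at h
  norm_num [← mul_assoc] at h
  rwa [ENNReal.inv_mul_cancel (by norm_num) (by norm_num), one_mul, one_mul] at h

/-- The epigraph of `c (·, ·, x)`; by convexity, homogeneity and lower semicontinuity it is a
closed convex cone in `ℝ² × ℝ`. -/
def epigraph (hc : IsLocalDiscrepancyIntegrand c) (x : Ω) : ProperCone ℝ ((ℝ × ℝ) × ℝ) where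
  carrier := {p | 0 ≤ p.2 ∧ c p.1.1 p.1.2 x ≤ ENNReal.ofReal p.2}
  zero_mem' := by simp [hc.diag x 0 le_rfl]
  add_mem' := by
    rintro p q ⟨hp, hp'⟩ ⟨hq, hq'⟩
    refine ⟨add_nonneg hp hq, ?_⟩
    simp only [Prod.fst_add, Prod.snd_add, ENNReal.ofReal_add hp hq]
    exact (hc.add_le x _ _ _ _).trans (add_le_add hp' hq')
  smul_mem' := by
    rintro ⟨t, ht⟩ p ⟨hp, hp'⟩
    rcases ht.eq_or_lt with rfl | ht'
    · simp [Nonneg.mk_smul, hc.diag x 0 le_rfl]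
    · refine ⟨mul_nonneg ht hp, ?_⟩
      simp only [Nonneg.mk_smul, Prod.smul_fst, Prod.smul_snd, smul_eq_mul]
      rw [hc.homogeneous x t _ _ ht', ENNReal.ofReal_mul ht]
      gcongr
  isClosed' := by
    have hlsc : LowerSemicontinuous fun m : ℝ × ℝ => c m.1 m.2 x :=
      hc.lowerSemicontinuous.comp (g := fun m : ℝ × ℝ => (m.1, m.2, x)) (by fun_prop)
    have h := hlsc.isClosed_epigraph
    exact (isClosed_le continuous_const continuous_snd).inter
      (h.preimage (f := fun p : (ℝ × ℝ) × ℝ => (p.1, ENNReal.ofReal p.2))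
        (continuous_fst.prodMk (ENNReal.continuous_ofReal.comp continuous_snd)))

theorem mem_epigraph (hc : IsLocalDiscrepancyIntegrand c) {x : Ω} {p : (ℝ × ℝ) × ℝ} :
    p ∈ hc.epigraph x ↔ 0 ≤ p.2 ∧ c p.1.1 p.1.2 x ≤ ENNReal.ofReal p.2 := Iff.rfl

/-- Duality at a point: `c (·, ·, x)` is the supremum of its linear minorants. -/
theorem exists_linear_minorant (hc : IsLocalDiscrepancyIntegrand c) {x : Ω} {m₀ m₁ a : ℝ}
    (ha : 0 ≤ a) (h : ENNReal.ofReal a < c m₀ m₁ x) :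
    ∃ b₀ b₁ : ℝ, a < b₀ * m₀ + b₁ * m₁ ∧
      ∀ n₀ n₁, ENNReal.ofReal (b₀ * n₀ + b₁ * n₁) ≤ c n₀ n₁ x := by
  obtain ⟨f, hf, hfa⟩ := (hc.epigraph x).hyperplane_separation_point (x₀ := ((m₀, m₁), a))
    (fun hm => not_le.mpr h (hc.mem_epigraph.mp hm).2)
  have hlin : ∀ n₀ n₁ t : ℝ, f ((n₀, n₁), t) =
      n₀ * f ((1, 0), 0) + n₁ * f ((0, 1), 0) + t * f ((0, 0), 1) := by
    intro n₀ n₁ t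
    have : ((n₀, n₁), t) = n₀ • (((1, 0), 0) : (ℝ × ℝ) × ℝ) + n₁ • (((0, 1), 0) : (ℝ × ℝ) × ℝ)
        + t • (((0, 0), 1) : (ℝ × ℝ) × ℝ) := by simp
    rw [this]; simp only [_root_.map_add, _root_.map_smul, smul_eq_mul]
  set p₀ := f ((1, 0), 0)
  set p₁ := f ((0, 1), 0)
  set s := f ((0, 0), 1) with hs_def
  have hs : 0 ≤ s := hf _ (hc.mem_epigraph.mpr ⟨zero_le_one, by simp [hc.diag x 0 le_rfl]⟩)
  rw [hlin] at hfa
  have hdual : ∀ n₀ n₁, c n₀ n₁ x ≠ ∞ → -(n₀ * p₀ + n₁ * p₁) ≤ (c n₀ n₁ x).toReal * s := by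
    intro n₀ n₁ hn
    have := hf ((n₀, n₁), (c n₀ n₁ x).toReal)
      (hc.mem_epigraph.mpr ⟨ENNReal.toReal_nonneg, by simp [ENNReal.ofReal_toReal hn]⟩)
    rw [hlin] at this
    linarith
  -- A uniform choice of scaling `r` covers both a sloped hyperplane (`s > 0`, where `r = 1 / s`)
  -- and a vertical one (`s = 0`, where `r` only has to be large).
  obtain ⟨r, hr, hrs, hra⟩ : ∃ r : ℝ, 0 ≤ r ∧ r * s ≤ 1 ∧ a < r * -(m₀ * p₀ + m₁ * p₁) := by
    rcases hs.eq_or_lt with h0 | hpos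
    · have hd : 0 < -(m₀ * p₀ + m₁ * p₁) := by rw [← h0] at hfa; linarith
      refine ⟨(a + 1) / -(m₀ * p₀ + m₁ * p₁), by positivity, by simp [← h0], ?_⟩
      rw [div_mul_cancel₀ _ hd.ne']; linarith
    · refine ⟨1 / s, by positivity, by rw [div_mul_cancel₀ _ hpos.ne'], ?_⟩
      rw [one_div_mul_eq_div, lt_div_iff₀ hpos]; linarith
  refine ⟨-(r * p₀), -(r * p₁), by linarith, fun n₀ n₁ => ?_⟩
  by_cases hn : c n₀ n₁ x = ∞
  · simp [hn]
  rw [ENNReal.ofReal_le_iff_le_toReal hn]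
  calc _ = r * -(n₀ * p₀ + n₁ * p₁) := by ring
    _ ≤ r * ((c n₀ n₁ x).toReal * s) := by gcongr; exact hdual n₀ n₁ hn
    _ = (r * s) * (c n₀ n₁ x).toReal := by ring
    _ ≤ 1 * (c n₀ n₁ x).toReal := by gcongr
    _ = _ := one_mul _

/-- A linear minorant can be made strict away from the origin, because `c` is infinite outside the
positive quadrant: decrease both coefficients by the same small amount. Strictness is phrased by a
disjunction since the values of `c` are not real. -/
theorem exists_strict_linear_minorant (hc : IsLocalDiscrepancyIntegrand c) {x : Ω} {m₀ m₁ a : ℝ}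
    (ha : 0 ≤ a) (h : ENNReal.ofReal a < c m₀ m₁ x) :
    ∃ b₀ b₁ : ℝ, a < b₀ * m₀ + b₁ * m₁ ∧
      ∀ n₀ n₁, (n₀, n₁) ≠ 0 →
        b₀ * n₀ + b₁ * n₁ < 0 ∨ ENNReal.ofReal (b₀ * n₀ + b₁ * n₁) < c n₀ n₁ x := by
  obtain ⟨b₀, b₁, hab, hb⟩ := hc.exists_linear_minorant ha h
  obtain ⟨ε, hε, hεa⟩ : ∃ ε : ℝ, 0 < ε ∧ ε * (m₀ + m₁) < b₀ * m₀ + b₁ * m₁ - a := by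
    refine ⟨(b₀ * m₀ + b₁ * m₁ - a) / (|m₀ + m₁| + 1), by
      have : 0 < b₀ * m₀ + b₁ * m₁ - a := by linarith
      positivity, ?_⟩
    rw [div_mul_eq_mul_div, div_lt_iff₀ (by positivity)]
    have := le_abs_self (m₀ + m₁)
    exact mul_lt_mul_of_pos_left (by linarith) (by linarith)
  refine ⟨b₀ - ε, b₁ - ε, by linarith, fun n₀ n₁ hn => ?_⟩
  by_cases hneg : n₀ < 0 ∨ n₁ < 0
  · right; rw [hc.eq_top x _ _ hneg]; exact ENNReal.ofReal_lt_top
  push Not at hneg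
  have hpos : 0 < n₀ + n₁ := by
    refine lt_of_le_of_ne (add_nonneg hneg.1 hneg.2) fun h0 => hn ?_
    have h₀ : n₀ = 0 := by linarith [hneg.1, hneg.2]
    have h₁ : n₁ = 0 := by linarith [hneg.1, hneg.2]
    simp [h₀, h₁]
  have hlt : (b₀ - ε) * n₀ + (b₁ - ε) * n₁ < b₀ * n₀ + b₁ * n₁ := by
    nlinarith [mul_pos hε hpos]
  rcases lt_or_ge ((b₀ - ε) * n₀ + (b₁ - ε) * n₁) 0 with h0 | h0
  · exact Or.inl h0
  · right
    exact ((ENNReal.ofReal_lt_ofReal_iff (h0.trans_lt hlt)).mpr hlt).trans_le (hb n₀ n₁)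

/-- A strict linear minorant of `c (·, ·, x)` is a linear minorant of `c (·, ·, y)` for all `y`
near `x`: by homogeneity it suffices to compare on the unit sphere, which is compact. -/
theorem eventually_linear_minorant (hc : IsLocalDiscrepancyIntegrand c) {x : Ω} {b₀ b₁ : ℝ}
    (hb : ∀ n₀ n₁, (n₀, n₁) ≠ 0 →
      b₀ * n₀ + b₁ * n₁ < 0 ∨ ENNReal.ofReal (b₀ * n₀ + b₁ * n₁) < c n₀ n₁ x) :
    ∀ᶠ y in nhds x, ∀ n₀ n₁, ENNReal.ofReal (b₀ * n₀ + b₁ * n₁) ≤ c n₀ n₁ y := by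
  have key : ∀ᶠ y in nhds x, ∀ n ∈ Metric.sphere (0 : ℝ × ℝ) 1,
      ENNReal.ofReal (b₀ * n.1 + b₁ * n.2) ≤ c n.1 n.2 y := by
    refine (isCompact_sphere (0 : ℝ × ℝ) 1).eventually_forall_of_forall_eventually fun n hn => ?_
    rcases hb n.1 n.2 (ne_zero_of_mem_unit_sphere ⟨n, hn⟩) with h | h
    · have hcont : Continuous fun z : Ω × (ℝ × ℝ) => b₀ * z.2.1 + b₁ * z.2.2 := by fun_prop
      filter_upwards [hcont.continuousAt.eventually_lt continuousAt_const h] with z hz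
      simp [ENNReal.ofReal_of_nonpos hz.le]
    · obtain ⟨r, hr, hr'⟩ := exists_between h
      have hcont : Continuous fun z : Ω × (ℝ × ℝ) =>
        ENNReal.ofReal (b₀ * z.2.1 + b₁ * z.2.2) :=
        ENNReal.continuous_ofReal.comp (by fun_prop)
      have hlsc : LowerSemicontinuous fun z : Ω × (ℝ × ℝ) => c z.2.1 z.2.2 z.1 :=
        hc.lowerSemicontinuous.comp (g := fun z : Ω × (ℝ × ℝ) => (z.2.1, z.2.2, z.1)) (by fun_prop)
      filter_upwards [hcont.continuousAt.eventually_lt continuousAt_const hr, hlsc (x, n) r hr']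
        with z hz hz'
      exact (hz.trans hz').le
  filter_upwards [key] with y hy n₀ n₁
  by_cases hn : (n₀, n₁) = 0
  · simp only [Prod.mk_eq_zero] at hn
    simp [hn.1, hn.2]
  · have ht : 0 < ‖(n₀, n₁)‖ := norm_pos_iff.mpr hn
    set t := ‖(n₀, n₁)‖
    have h1 := hy (t⁻¹ • (n₀, n₁)) (by
      rw [mem_sphere_zero_iff_norm, norm_smul, norm_inv, norm_norm, inv_mul_cancel₀ ht.ne'])
    have e₀ : n₀ = t * (t⁻¹ * n₀) := by field_simp
    have e₁ : n₁ = t * (t⁻¹ * n₁) := by field_simp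
    have e : b₀ * n₀ + b₁ * n₁ = t * (b₀ * (t⁻¹ * n₀) + b₁ * (t⁻¹ * n₁)) := by field_simp
    rw [e]
    conv_rhs => rw [e₀, e₁]
    rw [hc.homogeneous y t _ _ ht, ENNReal.ofReal_mul ht.le]
    gcongr
    simpa using h1

end IsLocalDiscrepancyIntegrand

/-! ### Continuous admissible pairs -/

/-- A pair `u ∈ C(Ω)²` is admissible for `c` if `u(x) · m ≤ c(m, x)` for all `m` and `x`, that is,
if `u(x)` lies in the subdifferential of `c (·, ·, x)` at the origin for every `x`. Since `c ≥ 0`,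
truncating the left-hand side at `0` loses nothing. -/
def IsAdmissible {Ω : Type*} [TopologicalSpace Ω] (c : ℝ → ℝ → Ω → ℝ≥0∞)
    (u : C(Ω, ℝ) × C(Ω, ℝ)) : Prop :=
  ∀ (x : Ω) (m₀ m₁ : ℝ), ENNReal.ofReal (u.1 x * m₀ + u.2 x * m₁) ≤ c m₀ m₁ x

theorem isAdmissible_zero {Ω : Type*} [TopologicalSpace Ω] (c : ℝ → ℝ → Ω → ℝ≥0∞) :
    IsAdmissible c 0 := fun x m₀ m₁ => by simp

/-- Admissible pairs are stable under convex combinations with continuously varying weights. -/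
theorem IsAdmissible.blend {Ω : Type*} [TopologicalSpace Ω] {c : ℝ → ℝ → Ω → ℝ≥0∞}
    {u v : C(Ω, ℝ) × C(Ω, ℝ)} (hu : IsAdmissible c u) (hv : IsAdmissible c v) {φ : C(Ω, ℝ)}
    (hφ : ∀ x, φ x ∈ Set.Icc (0 : ℝ) 1) :
    IsAdmissible c (φ * u.1 + (1 - φ) * v.1, φ * u.2 + (1 - φ) * v.2) := by
  intro x m₀ m₁
  obtain ⟨h0, h1⟩ := hφ x
  refine le_trans ?_ (max_le (hu x m₀ m₁) (hv x m₀ m₁))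
  rw [← ENNReal.ofReal_max]
  refine ENNReal.ofReal_le_ofReal ?_
  simp only [ContinuousMap.add_apply, ContinuousMap.mul_apply, ContinuousMap.sub_apply,
    ContinuousMap.one_apply]
  calc _ = φ x * (u.1 x * m₀ + u.2 x * m₁) + (1 - φ x) * (v.1 x * m₀ + v.2 x * m₁) := by ring
    _ ≤ φ x * max (u.1 x * m₀ + u.2 x * m₁) (v.1 x * m₀ + v.2 x * m₁)
        + (1 - φ x) * max (u.1 x * m₀ + u.2 x * m₁) (v.1 x * m₀ + v.2 x * m₁) := by
      have : 0 ≤ 1 - φ x := by linarith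
      gcongr
      · exact le_max_left _ _
      · exact le_max_right _ _
    _ = _ := by ring

/-- Admissible continuous pairs recover `c` pointwise: cut off a local constant linear minorant. -/
theorem IsLocalDiscrepancyIntegrand.exists_isAdmissible {Ω : Type*} [TopologicalSpace Ω]
    [NormalSpace Ω] [T1Space Ω] {c : ℝ → ℝ → Ω → ℝ≥0∞} (hc : IsLocalDiscrepancyIntegrand c)
    {x : Ω} {m₀ m₁ a : ℝ} (ha : 0 ≤ a) (h : ENNReal.ofReal a < c m₀ m₁ x) :
    ∃ u, IsAdmissible c u ∧ a < u.1 x * m₀ + u.2 x * m₁ := by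
  obtain ⟨b₀, b₁, hab, hb⟩ := hc.exists_strict_linear_minorant ha h
  obtain ⟨U, hU, hUo, hxU⟩ := eventually_nhds_iff.mp (hc.eventually_linear_minorant hb)
  obtain ⟨φ, hφ0, hφ1, hφ⟩ := exists_continuous_zero_one_of_isClosed hUo.isClosed_compl
    (isClosed_singleton (x := x)) (Set.disjoint_singleton_right.mpr (by simpa using hxU))
  have hφx : φ x = 1 := hφ1 rfl
  refine ⟨(φ * ContinuousMap.const Ω b₀, φ * ContinuousMap.const Ω b₁), fun y n₀ n₁ => ?_, ?_⟩
  · by_cases hy : y ∈ U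
    · refine le_trans ?_ (hU y hy n₀ n₁)
      simp only [ContinuousMap.mul_apply, ContinuousMap.const_apply, mul_assoc, ← mul_add]
      rw [ENNReal.ofReal_mul (hφ y).1]
      exact mul_le_of_le_one_left (by positivity) (by simpa using (hφ y).2)
    · have : φ y = 0 := hφ0 hy
      simp [this]
  · simpa [hφx] using hab

/-- Countably many admissible pairs suffice to recover `c`, because `C(Ω)²` is separable. -/
theorem IsLocalDiscrepancyIntegrand.exists_seq_iSup_eq {Ω : Type*} [MetricSpace Ω]
    [CompactSpace Ω] {c : ℝ → ℝ → Ω → ℝ≥0∞} (hc : IsLocalDiscrepancyIntegrand c) :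
    ∃ u : ℕ → C(Ω, ℝ) × C(Ω, ℝ), (∀ n, IsAdmissible c (u n)) ∧ ∀ x m₀ m₁,
      c m₀ m₁ x = ⨆ n, ENNReal.ofReal ((u n).1 x * m₀ + (u n).2 x * m₁) := by
  have : Nonempty {u // IsAdmissible c u} := ⟨⟨0, isAdmissible_zero c⟩⟩
  refine ⟨fun n => (TopologicalSpace.denseSeq {u // IsAdmissible c u} n).1,
    fun n => (TopologicalSpace.denseSeq {u // IsAdmissible c u} n).2,
    fun x m₀ m₁ => le_antisymm ?_ ?_⟩
  · refine le_of_forall_lt fun b hb => ?_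
    lift b to ℝ≥0 using hb.ne_top
    obtain ⟨u, hu, hlt⟩ := hc.exists_isAdmissible b.2 (by simpa using hb)
    have hcont : Continuous fun v : {u // IsAdmissible c u} =>
        v.1.1 x * m₀ + v.1.2 x * m₁ := by fun_prop
    obtain ⟨n, hv⟩ := (TopologicalSpace.denseRange_denseSeq
      {u // IsAdmissible c u}).exists_mem_open (isOpen_lt continuous_const hcont) ⟨⟨u, hu⟩, hlt⟩
    refine lt_iSup_iff.mpr ⟨n, ?_⟩
    rw [← ENNReal.ofReal_coe_nnreal]
    exact (ENNReal.ofReal_lt_ofReal_iff (b.2.trans_lt hv)).mpr hv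
  · exact iSup_le fun n => (TopologicalSpace.denseSeq {u // IsAdmissible c u} n).2 x m₀ m₁

/-! ### Integration against signed measures -/

/-- The integral against a signed measure in terms of its Radon–Nikodym derivative. -/
theorem signedMeasure_integral_eq_integral_mul_rnDeriv {Ω : Type*} [TopologicalSpace Ω]
    [CompactSpace Ω] [MeasurableSpace Ω] [BorelSpace Ω] (s : SignedMeasure Ω) (μ : Measure Ω)
    [IsFiniteMeasure μ] (hs : s.totalVariation ≪ μ) (u : C(Ω, ℝ)) :
    ∫ᵛ x, u x ∂<•s = ∫ x, u x * s.rnDeriv μ x ∂μ := by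
  set p := s.toJordanDecomposition.posPart with hp
  set n := s.toJordanDecomposition.negPart with hn
  have hpμ : p ≪ μ := (Measure.le_add_right le_rfl).absolutelyContinuous.trans hs
  have hnμ : n ≪ μ := (Measure.le_add_left le_rfl).absolutelyContinuous.trans hs
  have hint : ∀ (ν : Measure Ω) [IsFiniteMeasure ν], Integrable u ν := fun ν _ =>
    (BoundedContinuousFunction.mkOfCompact u).integrable ν
  have hs' : s = p.toSignedMeasure - n.toSignedMeasure := by
    conv_lhs => rw [← s.toSignedMeasure_toJordanDecomposition]
    rfl
  have hd : ∀ (ν : Measure Ω) [IsFiniteMeasure ν], ν ≪ μ →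
      Integrable (fun x => (ν.rnDeriv μ x).toReal * u x) μ ∧
        ∫ x, (ν.rnDeriv μ x).toReal * u x ∂μ = ∫ x, u x ∂ν := fun ν _ hν =>
    ⟨(integrable_rnDeriv_smul_iff hν).mpr (hint ν), integral_rnDeriv_smul hν⟩
  have hsub : ∫ᵛ x, u x ∂<•s = ∫ x, u x ∂p - ∫ x, u x ∂n := by
    conv_lhs => rw [hs']
    rw [VectorMeasure.integral_sub_vectorMeasure, integral_toSignedMeasure,
      integral_toSignedMeasure]
    · simpa [VectorMeasure.Integrable] using hint p
    · simpa [VectorMeasure.Integrable] using hint n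
  rw [hsub, ← (hd p hpμ).2, ← (hd n hnμ).2, ← integral_sub (hd p hpμ).1 (hd n hnμ).1]
  refine integral_congr_ae (Filter.Eventually.of_forall fun x => ?_)
  simp only [SignedMeasure.rnDeriv_def]
  ring

/-! ### Approximating maxima in `L¹` -/

theorem abs_clamp_sub_le {t y : ℝ} (ht : t ∈ Set.Icc (0 : ℝ) 1) :
    |t - max 0 (min 1 y)| ≤ |t - y| := by
  have h1 : |min 1 t - min 1 y| ≤ |t - y| := by
    simpa using abs_min_sub_min_le_max 1 t 1 y
  have h2 : |max 0 (min 1 t) - max 0 (min 1 y)| ≤ |min 1 t - min 1 y| := by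
    simpa using abs_max_sub_max_le_max 0 (min 1 t) 0 (min 1 y)
  rw [min_eq_right ht.2, max_eq_right ht.1] at h2
  rw [min_eq_right ht.2] at h1
  exact h2.trans h1

/-- The maximum of two integrable functions is an `L¹`-limit of their convex combinations with
continuous weights: approximate the indicator of `{g ≤ f}` in `L¹(|f - g| μ)`. -/
theorem exists_continuous_blend_lintegral_le {Ω : Type*} [TopologicalSpace Ω]
    [TopologicalSpace.PseudoMetrizableSpace Ω] [MeasurableSpace Ω] [BorelSpace Ω] (μ : Measure Ω)
    {f g : Ω → ℝ}
    (hfm : Measurable f) (hgm : Measurable g) (hf : Integrable f μ) (hg : Integrable g μ)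
    {ε : ℝ≥0∞} (hε : ε ≠ 0) :
    ∃ φ : C(Ω, ℝ), (∀ x, φ x ∈ Set.Icc (0 : ℝ) 1) ∧
      ∫⁻ x, ‖φ x * f x + (1 - φ x) * g x - max (f x) (g x)‖ₑ ∂μ ≤ ε := by
  set ν := μ.withDensity fun x => ‖f x - g x‖ₑ with hν
  have hνfin : IsFiniteMeasure ν := isFiniteMeasure_withDensity (hf.sub hg).2.ne
  have hA : MeasurableSet {x | g x ≤ f x} := measurableSet_le hgm hfm
  obtain ⟨ψ, hψ, -⟩ := ((integrable_const (1 : ℝ)).indicator (μ := ν)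
    hA).exists_boundedContinuous_lintegral_sub_le hε
  refine ⟨⟨fun x => max 0 (min 1 (ψ x)), by fun_prop⟩, fun x => ⟨le_max_left _ _, by simp⟩, ?_⟩
  refine le_trans ?_ hψ
  have hmeas : Measurable fun x => ‖Set.indicator {x | g x ≤ f x} (fun _ => (1 : ℝ)) x - ψ x‖ₑ :=
    ((measurable_const.indicator hA).sub ψ.continuous.measurable).enorm
  rw [hν, lintegral_withDensity_eq_lintegral_mul₀ (by fun_prop) hmeas.aemeasurable]
  refine lintegral_mono fun x => ?_
  set t : ℝ := Set.indicator {x | g x ≤ f x} (fun _ => (1 : ℝ)) x with ht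
  have hmax : max (f x) (g x) = t * f x + (1 - t) * g x := by
    by_cases hx : g x ≤ f x
    · simp [ht, hx]
    · simp [ht, hx, (not_le.mp hx).le]
  have htI : t ∈ Set.Icc (0 : ℝ) 1 := by
    by_cases hx : g x ≤ f x <;> simp [ht, hx]
  simp only [ContinuousMap.coe_mk, Pi.mul_apply]
  rw [← enorm_mul, enorm_le_iff_norm_le, Real.norm_eq_abs, Real.norm_eq_abs, hmax,
    abs_mul (f x - g x)]
  calc _ = |t - max 0 (min 1 (ψ x))| * |f x - g x| := by
        rw [← abs_mul, ← abs_neg]; congr 1; ring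
    _ ≤ |t - ψ x| * |f x - g x| :=
        mul_le_mul_of_nonneg_right (abs_clamp_sub_le htI) (abs_nonneg _)
    _ = _ := mul_comm _ _

section Duality

/-- `h` lies in the `L¹(μ)`-closure of the functions `u · r` with `u` admissible, where
`r = (r₀, r₁)`. -/
def IsAdmissibleLimit {Ω : Type*} [TopologicalSpace Ω] [MeasurableSpace Ω]
    (c : ℝ → ℝ → Ω → ℝ≥0∞) (μ : Measure Ω) (r₀ r₁ h : Ω → ℝ) : Prop :=
  ∀ ε : ℝ≥0∞, ε ≠ 0 → ∃ u, IsAdmissible c u ∧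
    ∫⁻ x, ‖u.1 x * r₀ x + u.2 x * r₁ x - h x‖ₑ ∂μ ≤ ε

theorem IsAdmissible.isAdmissibleLimit {Ω : Type*} [TopologicalSpace Ω] [MeasurableSpace Ω]
    {c : ℝ → ℝ → Ω → ℝ≥0∞} {μ : Measure Ω} {r₀ r₁ : Ω → ℝ} {u : C(Ω, ℝ) × C(Ω, ℝ)}
    (hu : IsAdmissible c u) :
    IsAdmissibleLimit c μ r₀ r₁ fun x => u.1 x * r₀ x + u.2 x * r₁ x :=
  fun ε _ => ⟨u, hu, by simp⟩

variable {Ω : Type*} [MetricSpace Ω] [CompactSpace Ω] [MeasurableSpace Ω] [BorelSpace Ω]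
  {c : ℝ → ℝ → Ω → ℝ≥0∞} {μ : Measure Ω} {r₀ r₁ : Ω → ℝ}

theorem integrable_continuousMap_mul_add (hr₀ : Integrable r₀ μ) (hr₁ : Integrable r₁ μ)
    (u : C(Ω, ℝ) × C(Ω, ℝ)) : Integrable (fun x => u.1 x * r₀ x + u.2 x * r₁ x) μ := by
  have h : ∀ (v : C(Ω, ℝ)) {r : Ω → ℝ}, Integrable r μ → Integrable (fun x => v x * r x) μ :=
    fun v r hr => hr.bdd_mul v.continuous.measurable.aestronglyMeasurable
      (Filter.Eventually.of_forall fun x => v.norm_coe_le_norm x)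
  exact (h u.1 hr₀).add (h u.2 hr₁)

theorem IsAdmissibleLimit.max {f g : Ω → ℝ} (hm₀ : Measurable r₀) (hm₁ : Measurable r₁)
    (hr₀ : Integrable r₀ μ) (hr₁ : Integrable r₁ μ) (hfm : Measurable f) (hgm : Measurable g)
    (hf : IsAdmissibleLimit c μ r₀ r₁ f) (hg : IsAdmissibleLimit c μ r₀ r₁ g) :
    IsAdmissibleLimit c μ r₀ r₁ fun x => max (f x) (g x) := by
  intro ε hε
  have hε3 : ε / 3 ≠ 0 := ENNReal.div_ne_zero.mpr ⟨hε, by simp⟩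
  obtain ⟨u, hu, huf⟩ := hf (ε / 3) hε3
  obtain ⟨v, hv, hvg⟩ := hg (ε / 3) hε3
  obtain ⟨φ, hφ, hφε⟩ := exists_continuous_blend_lintegral_le μ
    (f := fun x => u.1 x * r₀ x + u.2 x * r₁ x) (g := fun x => v.1 x * r₀ x + v.2 x * r₁ x)
    (by fun_prop) (by fun_prop) (integrable_continuousMap_mul_add hr₀ hr₁ u)
    (integrable_continuousMap_mul_add hr₀ hr₁ v) hε3
  refine ⟨_, hu.blend hv hφ, ?_⟩
  refine le_trans ?_ ((add_le_add (add_le_add hφε huf) hvg).trans (ENNReal.add_thirds ε).le)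
  rw [← lintegral_add_right _ (by fun_prop), ← lintegral_add_right _ (by fun_prop)]
  refine lintegral_mono fun x => ?_
  simp only [ContinuousMap.add_apply, ContinuousMap.mul_apply, ContinuousMap.sub_apply,
    ContinuousMap.one_apply]
  set p := u.1 x * r₀ x + u.2 x * r₁ x
  set q := v.1 x * r₀ x + v.2 x * r₁ x
  have hmax : ‖Max.max p q - Max.max (f x) (g x)‖ₑ ≤ ‖p - f x‖ₑ + ‖q - g x‖ₑ := by
    simp only [← ofReal_norm, Real.norm_eq_abs]
    rw [← ENNReal.ofReal_add (abs_nonneg _) (abs_nonneg _)]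
    refine ENNReal.ofReal_le_ofReal ((abs_max_sub_max_le_max _ _ _ _).trans ?_)
    exact max_le_add_of_nonneg (abs_nonneg _) (abs_nonneg _)
  calc _ = ‖(φ x * p + (1 - φ x) * q - Max.max p q) + (Max.max p q - Max.max (f x) (g x))‖ₑ := by
        congr 1; ring
    _ ≤ ‖φ x * p + (1 - φ x) * q - Max.max p q‖ₑ + (‖p - f x‖ₑ + ‖q - g x‖ₑ) :=
        (enorm_add_le _ _).trans (by gcongr)
    _ = _ := (add_assoc _ _ _).symm

/-- For a nonnegative admissible limit `h`, the integral of `h` is at most the supremum of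
`∫ u · r dμ` over admissible `u`. -/
theorem IsAdmissibleLimit.lintegral_le {h : Ω → ℝ} (hr₀ : Integrable r₀ μ) (hr₁ : Integrable r₁ μ)
    (h_nonneg : ∀ x, 0 ≤ h x) (hint : Integrable h μ) (hh : IsAdmissibleLimit c μ r₀ r₁ h) :
    ∫⁻ x, ENNReal.ofReal (h x) ∂μ ≤ ⨆ (u : C(Ω, ℝ) × C(Ω, ℝ)) (_ : IsAdmissible c u),
      ENNReal.ofReal (∫ x, u.1 x * r₀ x + u.2 x * r₁ x ∂μ) := by
  refine ENNReal.le_of_forall_pos_le_add fun ε hε _ => ?_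
  obtain ⟨u, hu, huε⟩ := hh ε (by simpa using hε.ne')
  have hui := integrable_continuousMap_mul_add hr₀ hr₁ u
  rw [← ofReal_integral_eq_lintegral_ofReal hint (Filter.Eventually.of_forall h_nonneg)]
  have hdi : Integrable (fun x => u.1 x * r₀ x + u.2 x * r₁ x - h x) μ := hui.sub hint
  have hle : ∫ x, h x ∂μ ≤ ∫ x, u.1 x * r₀ x + u.2 x * r₁ x ∂μ
      + ∫ x, ‖u.1 x * r₀ x + u.2 x * r₁ x - h x‖ ∂μ := by
    rw [← integral_add hui hdi.norm]
    refine integral_mono hint (hui.add hdi.norm) fun x => ?_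
    have := neg_abs_le (u.1 x * r₀ x + u.2 x * r₁ x - h x)
    simp only [Real.norm_eq_abs]
    linarith
  calc _ ≤ _ := ENNReal.ofReal_le_ofReal hle
    _ ≤ ENNReal.ofReal (∫ x, u.1 x * r₀ x + u.2 x * r₁ x ∂μ)
        + ENNReal.ofReal (∫ x, ‖u.1 x * r₀ x + u.2 x * r₁ x - h x‖ ∂μ) := ENNReal.ofReal_add_le
    _ ≤ _ := by
      gcongr
      · exact le_iSup₂_of_le u hu le_rfl
      · rw [ofReal_integral_norm_eq_lintegral_enorm hdi]
        exact huε

/-! ### The dual formula -/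

/-- Duality for the integral functional with arbitrary integrable densities `r₀, r₁`. For `≤`, the
integrand is an increasing limit of maxima of finitely many functions `u · r`, to which monotone
convergence applies, and each such maximum is an admissible limit. -/
theorem lintegral_eq_iSup_isAdmissible (hc : IsLocalDiscrepancyIntegrand c)
    (hm₀ : Measurable r₀) (hm₁ : Measurable r₁) (hr₀ : Integrable r₀ μ) (hr₁ : Integrable r₁ μ) :
    ∫⁻ x, c (r₀ x) (r₁ x) x ∂μ = ⨆ (u : C(Ω, ℝ) × C(Ω, ℝ)) (_ : IsAdmissible c u),
      ENNReal.ofReal (∫ x, u.1 x * r₀ x + u.2 x * r₁ x ∂μ) := by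
  refine le_antisymm ?_ (iSup₂_le fun u hu => ?_)
  · obtain ⟨u, hu, hsup⟩ := hc.exists_seq_iSup_eq
    -- `h n` is the maximum of `0` and the first `n` of the functions `u k · r`.
    let h : ℕ → Ω → ℝ := fun n => Nat.rec (fun _ => 0)
      (fun k f x => max (f x) ((u k).1 x * r₀ x + (u k).2 x * r₁ x)) n
    have h_succ : ∀ n x, h (n + 1) x = max (h n x) ((u n).1 x * r₀ x + (u n).2 x * r₁ x) :=
      fun n x => rfl
    have h_mono : Monotone h := monotone_nat_of_le_succ fun n x => by
      rw [h_succ]; exact le_max_left _ _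
    have h_nonneg : ∀ n x, 0 ≤ h n x := fun n x => h_mono (Nat.zero_le n) x
    have h_props : ∀ n, Measurable (h n) ∧ Integrable (h n) μ ∧
        IsAdmissibleLimit c μ r₀ r₁ (h n) := by
      intro n
      induction n with
      | zero =>
        refine ⟨measurable_const, integrable_zero _ _ _, ?_⟩
        exact fun ε _ => ⟨0, isAdmissible_zero c, by simp [h]⟩
      | succ n ih =>
        have hum : Measurable fun x => (u n).1 x * r₀ x + (u n).2 x * r₁ x := by fun_prop
        exact ⟨ih.1.max hum, ih.2.1.sup (integrable_continuousMap_mul_add hr₀ hr₁ (u n)),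
          ih.2.2.max hm₀ hm₁ hr₀ hr₁ ih.1 hum (hu n).isAdmissibleLimit⟩
    have h_le : ∀ x, c (r₀ x) (r₁ x) x ≤ ⨆ n, ENNReal.ofReal (h n x) := by
      intro x
      rw [hsup]
      refine iSup_le fun n => le_iSup_of_le (n + 1) (ENNReal.ofReal_le_ofReal ?_)
      rw [h_succ]; exact le_max_right _ _
    calc _ ≤ ∫⁻ x, ⨆ n, ENNReal.ofReal (h n x) ∂μ := lintegral_mono h_le
      _ = ⨆ n, ∫⁻ x, ENNReal.ofReal (h n x) ∂μ :=
        lintegral_iSup (fun n => (h_props n).1.ennreal_ofReal)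
          fun m n hmn x => ENNReal.ofReal_le_ofReal (h_mono hmn x)
      _ ≤ _ := iSup_le fun n =>
        (h_props n).2.2.lintegral_le hr₀ hr₁ (h_nonneg n) (h_props n).2.1
  · have hui := integrable_continuousMap_mul_add hr₀ hr₁ u
    calc _ ≤ ENNReal.ofReal (∫ x, max (u.1 x * r₀ x + u.2 x * r₁ x) 0 ∂μ) :=
        ENNReal.ofReal_le_ofReal (integral_mono hui hui.pos_part fun x => le_max_left _ _)
      _ = ∫⁻ x, ENNReal.ofReal (max (u.1 x * r₀ x + u.2 x * r₁ x) 0) ∂μ :=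
        ofReal_integral_eq_lintegral_ofReal hui.pos_part
          (Filter.Eventually.of_forall fun x => le_max_right _ _)
      _ ≤ _ := lintegral_mono fun x => by
        rw [ENNReal.ofReal_max, ENNReal.ofReal_zero, max_eq_left (zero_le)]
        exact hu x _ _

/-- The dual formula: the local discrepancy is the support function of the admissible pairs. -/
theorem localDiscrepancy_eq_iSup_dualPairing (hc : IsLocalDiscrepancyIntegrand c)
    (ρ : SignedMeasure Ω × SignedMeasure Ω) :
    localDiscrepancy c ρ.1 ρ.2 = ⨆ (u : C(Ω, ℝ) × C(Ω, ℝ)) (_ : IsAdmissible c u),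
      ENNReal.ofReal (dualPairing u ρ) := by
  unfold localDiscrepancy discrepancyIntegral
  set μ := ρ.1.totalVariation + ρ.2.totalVariation
  have h₀ := SignedMeasure.integrable_rnDeriv ρ.1 μ
  have h₁ := SignedMeasure.integrable_rnDeriv ρ.2 μ
  rw [lintegral_eq_iSup_isAdmissible hc (SignedMeasure.measurable_rnDeriv _ _)
    (SignedMeasure.measurable_rnDeriv _ _) h₀ h₁]
  refine iSup_congr fun u => iSup_congr fun _ => ?_
  have hu₀ := integrable_continuousMap_mul_add h₀ h₁ (u.1, 0)
  have hu₁ := integrable_continuousMap_mul_add h₀ h₁ (0, u.2)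
  simp only [ContinuousMap.zero_apply, zero_mul, add_zero, zero_add] at hu₀ hu₁
  rw [dualPairing, integral_add hu₀ hu₁,
    signedMeasure_integral_eq_integral_mul_rnDeriv ρ.1 μ
      (Measure.le_add_right le_rfl).absolutelyContinuous,
    signedMeasure_integral_eq_integral_mul_rnDeriv ρ.2 μ
      (Measure.le_add_left le_rfl).absolutelyContinuous]

end Duality

/-! ### Lower semicontinuity -/

theorem mainTheorem12 {Ω : Type*} [MetricSpace Ω] [CompactSpace Ω] [MeasurableSpace Ω]
    [BorelSpace Ω] (c : ℝ → ℝ → Ω → ℝ≥0∞) (hc : IsLocalDiscrepancyIntegrand c) :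
    @LowerSemicontinuous (SignedMeasure Ω × SignedMeasure Ω) ℝ≥0∞ (weakStarTopology Ω) _
      (fun ρ => localDiscrepancy c ρ.1 ρ.2) := by
  simp only [localDiscrepancy_eq_iSup_dualPairing hc]
  let _ := weakStarTopology Ω
  exact lowerSemicontinuous_biSup fun u _ => (ENNReal.continuous_ofReal.comp
    (continuous_iInf_dom (i := u) continuous_induced_dom)).lowerSemicontinuous
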